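/- **Theorem 5.1 (Fenchel conjugates of optimal value functions).** Let $X$ and $Y$ be real Hausdorff locally convex topological vector spaces with topological duals $X^*$, $Y^*$; the dual of $X\times Y$ is identified with $X^*\times Y^*$. Let $\varphi\colon X\times Y\to(-\infty,\infty]$ be a convex function, let $F\colon X\rightrightarrows Y$ be a set-valued mapping whose graph $\operatorname{gph}F=\{(x,y)\mid y\in F(x)\}$ is a convex subset of $X\times Y$, and let $$\mu(x):=\inf\{\varphi(x,y)\mid y\in F(x)\},\quad x\in X\qquad(\inf\emptyset=\infty).$$ For a function $f$ on a space $E$ with values in $[-\infty,\infty]$ put $f^*(x^*):=\sup_{x\in E}\{\langle x^*,x\rangle-f(x)\}$, $x^*\in E^*$; for $\Omega\subset E$ let $\delta_\Omega$ be $0$ on $\Omega$ and $\infty$ off $\Omega$, and let $\sigma_\Omega(x^*):=\sup_{x\in\Omega}\langle x^*,x\rangle$; let $\operatorname{dom}f:=\{x\mid f(x)<\infty\}$ and $(f\oplus g)(x):=\inf_u\{f(u)+g(x-u)\}$. Then $$\mu^*(x^*)=\big(\varphi+\delta_{\operatorname{gph}F}\big)^*(x^*,0)\quad\text{for all }x^*\in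 X^*.$$ Furthermore, $$\mu^*(x^*)=\big(\varphi^*\oplus\sigma_{\operatorname{gph}F}\big)(x^*,0)\quad\text{for all }x^*\in X^*$$ holds if at least one of the following conditions is satisfied: (i) $\varphi$ is finite and continuous at some point $(\bar x,\bar y)\in\operatorname{gph}F$; (ii) $X$ and $Y$ are Banach spaces, $\varphi$ is lower semicontinuous, $\operatorname{gph}F$ is closed, and the set $\{t(u-v)\mid t>0,\ u\in\operatorname{dom}\varphi,\ v\in\operatorname{gph}F\}$ is a closed linear subspace of $X\times Y$. -/

import Mathlib

open scoped Pointwise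

/-- The effective domain `{x | f x < ∞}` of an extended-real-valued function. -/
def effDom {E : Type*} (f : E → EReal) : Set E := {x | f x < ⊤}

/-- The epigraph `{(x, r) ∈ E × ℝ | f x ≤ r}`. -/
def epigraphE {E : Type*} (f : E → EReal) : Set (E × ℝ) := {p | f p.1 ≤ (p.2 : EReal)}

/-- A convex function with values in `(-∞, ∞]`: it never takes the value `-∞`, and its epigraph
is a convex set. -/
structure IsConvexFun {E : Type*} [AddCommGroup E] [Module ℝ E] (f : E → EReal) : Prop where
  ne_bot : ∀ x, f x ≠ ⊥
  convex_epi : Convex ℝ (epigraphE f)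

open Classical in
/-- The indicator function of a set: `0` on the set and `∞` off it. -/
noncomputable def indicatorE {E : Type*} (Ω : Set E) (x : E) : EReal := if x ∈ Ω then 0 else ⊤

/-- The Fenchel conjugate `f*(x*) = sup_x (⟨x*, x⟩ - f x)` on the topological dual. -/
noncomputable def fenchelConj {E : Type*} [AddCommGroup E] [Module ℝ E] [TopologicalSpace E]
    (f : E → EReal) (xs : StrongDual ℝ E) : EReal :=
  ⨆ x : E, ((xs x : ℝ) : EReal) - f x

/-- The support function `σ_Ω(x*) = sup_{x ∈ Ω} ⟨x*, x⟩` on the topological dual. -/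
noncomputable def supportFun {E : Type*} [AddCommGroup E] [Module ℝ E] [TopologicalSpace E]
    (Ω : Set E) (xs : StrongDual ℝ E) : EReal :=
  ⨆ x ∈ Ω, ((xs x : ℝ) : EReal)

/-- The infimal convolution `(f ⊕ g)(x) = inf_u (f u + g (x - u))`. -/
noncomputable def infConv {E : Type*} [AddCommGroup E] (f g : E → EReal) (x : E) : EReal :=
  ⨅ u : E, f u + g (x - u)

/-- The graph `{(x, y) | y ∈ F x}` of a set-valued mapping. -/
def gphOf {X Y : Type*} (F : X → Set Y) : Set (X × Y) := {z | z.2 ∈ F z.1}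

/-- The marginal (optimal value) function `μ(x) = inf {φ(x, y) | y ∈ F x}`, with `inf ∅ = ∞`. -/
noncomputable def marginalFun {X Y : Type*} (φ : X × Y → EReal) (F : X → Set Y) (x : X) : EReal :=
  ⨅ y ∈ F x, φ (x, y)

/-- `ℝ⁺(Ω) = {t v | t > 0, v ∈ Ω}`. -/
def posMultiples {E : Type*} [AddCommGroup E] [Module ℝ E] (Ω : Set E) : Set E :=
  {w | ∃ t : ℝ, 0 < t ∧ ∃ v ∈ Ω, w = t • v}

/-- The set `S` is a closed linear subspace. -/
def IsClosedSubspace {E : Type*} [AddCommGroup E] [Module ℝ E] [TopologicalSpace E]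
    (S : Set E) : Prop :=
  IsClosed S ∧ ∃ L : Submodule ℝ E, (L : Set E) = S

/-! The first formula is an interchange of suprema over `x` and `y ∈ F x`. For the second, with `f =
φ` and `Ω = gph F`, the inequality `≤` is weak duality. For `≥`, let the left side be a real number
`A`. The perturbation function `p ↦ inf_{v ∈ Ω} (f (p + v) - xs v + A)` is convex and nonnegative at
`0`, and any continuous linear functional below it attains the infimum in the convolution
(`fenchelConj_add_indicatorE_eq_infConv`). Such a functional exists once the epigraph is a
neighbourhood of a point over `0` (`Convex.exists_strongDual_le`). Continuity of `f` gives this at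
once. In the Banach case it holds for perturbations in the closed subspace `L` only, by a Baire
argument (`exists_ball_subset_image_of_absorbing`), and Hahn-Banach extends the functional from `L`.
-/

/-- Swapping the subtrahend and the bound in an inequality with a real minuend. -/
lemma EReal.coe_sub_le_comm (a : ℝ) (b c : EReal) : (a : EReal) - b ≤ c ↔ (a : EReal) - c ≤ b := by
  cases b with
  | bot =>
    cases c with
    | bot => simp
    | top => simp
    | coe c => simpa using EReal.coe_ne_bot (a - c)
  | top => cases c <;> simp
  | coe b =>
    cases c with
    | bot => simpa using EReal.coe_ne_bot (a - b)
    | top => simp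
    | coe c => norm_cast; exact sub_le_comm

/-! ### Conjugates of marginal functions -/

section Marginal

variable {X Y : Type*} [AddCommGroup X] [Module ℝ X] [TopologicalSpace X]
  [AddCommGroup Y] [Module ℝ Y] [TopologicalSpace Y]

lemma fenchelConj_add_indicatorE {E : Type*} [AddCommGroup E] [Module ℝ E] [TopologicalSpace E]
    {f : E → EReal} (hf : ∀ x, f x ≠ ⊥) (Ω : Set E) (xs : StrongDual ℝ E) :
    fenchelConj (fun z => f z + indicatorE Ω z) xs = ⨆ z ∈ Ω, ((xs z : ℝ) : EReal) - f z := by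
  refine iSup_congr fun z => ?_
  by_cases hz : z ∈ Ω
  · simp [indicatorE, hz]
  · simp [indicatorE, hz, EReal.add_top_of_ne_bot (hf z)]

/-- Since the marginal function may take the values `±∞`, its infimum is pulled out of the
difference by `EReal.coe_sub_le_comm` rather than by real arithmetic. -/
lemma fenchelConj_marginalFun {φ : X × Y → EReal} (hφ : ∀ z, φ z ≠ ⊥) (F : X → Set Y)
    (xs : StrongDual ℝ X) :
    fenchelConj (marginalFun φ F) xs =
      fenchelConj (fun z => φ z + indicatorE (gphOf F) z) (xs.coprod (0 : StrongDual ℝ Y)) := by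
  rw [fenchelConj_add_indicatorE hφ]
  apply le_antisymm
  · refine iSup_le fun x => ?_
    rw [EReal.coe_sub_le_comm]
    refine le_iInf₂ fun y hy => ?_
    rw [EReal.coe_sub_le_comm]
    refine le_iSup₂_of_le (x, y) hy ?_
    simp
  · refine iSup₂_le fun z hz => ?_
    refine le_iSup_of_le z.1 ?_
    have h : marginalFun φ F z.1 ≤ φ z := iInf₂_le z.2 hz
    simpa using EReal.sub_le_sub le_rfl h

end Marginal

/-! ### Weak duality, and strong duality by separation -/

section Duality

variable {E : Type*} [AddCommGroup E] [Module ℝ E] [TopologicalSpace E]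

lemma fenchelConj_add_indicatorE_le_infConv [IsTopologicalAddGroup E] {f : E → EReal}
    (hf : ∀ x, f x ≠ ⊥) (Ω : Set E) (xs : StrongDual ℝ E) :
    fenchelConj (fun z => f z + indicatorE Ω z) xs ≤
      infConv (fenchelConj f) (supportFun Ω) xs := by
  rw [fenchelConj_add_indicatorE hf]
  refine le_iInf fun u => iSup₂_le fun z hz => ?_
  have h1 : ((u z : ℝ) : EReal) - f z ≤ fenchelConj f u :=
    le_iSup (fun x : E => ((u x : ℝ) : EReal) - f x) z
  have h2 : (((xs - u) z : ℝ) : EReal) ≤ supportFun Ω (xs - u) :=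
    le_iSup₂ (f := fun (x : E) (_ : x ∈ Ω) => (((xs - u) x : ℝ) : EReal)) z hz
  refine le_trans (le_of_eq ?_) (add_le_add h1 h2)
  have h3 := hf z
  induction h : f z with
  | bot => exact absurd h h3
  | top => simp
  | coe r => norm_cast; simp

/-- The conjugate of a sum with an indicator is the infimal convolution of the conjugates as soon
as every affine minorant on the set is dominated by a separating functional. -/
lemma fenchelConj_add_indicatorE_eq_infConv [IsTopologicalAddGroup E] {f : E → EReal}
    (hf : ∀ x, f x ≠ ⊥) {Ω : Set E} {z₀ : E} (hz₀ : z₀ ∈ Ω) (hfz₀ : f z₀ ≠ ⊤)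
    (xs : StrongDual ℝ E)
    (hsep : ∀ A : ℝ, (∀ z ∈ Ω, ∀ r : ℝ, f z ≤ r → xs z - A ≤ r) →
      ∃ h : StrongDual ℝ E, ∀ u (r : ℝ), f u ≤ r → ∀ v ∈ Ω, h u - h v ≤ r - xs v + A) :
    fenchelConj (fun z => f z + indicatorE Ω z) xs =
      infConv (fenchelConj f) (supportFun Ω) xs := by
  refine le_antisymm (fenchelConj_add_indicatorE_le_infConv hf Ω xs) ?_
  rw [fenchelConj_add_indicatorE hf]
  induction hS : ⨆ z ∈ Ω, ((xs z : ℝ) : EReal) - f z with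
  | top => exact le_top
  | bot =>
    have h := le_iSup₂ (f := fun (z : E) (_ : z ∈ Ω) => ((xs z : ℝ) : EReal) - f z) z₀ hz₀
    rw [hS] at h
    lift f z₀ to ℝ using ⟨hfz₀, hf z₀⟩ with r
    norm_cast at h
  | coe A =>
    obtain ⟨h, hh⟩ := hsep A fun z hz r hr => by
      have h1 := le_iSup₂ (f := fun (z : E) (_ : z ∈ Ω) => ((xs z : ℝ) : EReal) - f z) z hz
      rw [hS, EReal.coe_sub_le_comm] at h1
      exact_mod_cast h1.trans hr
    have hle : ∀ v ∈ Ω, fenchelConj f h ≤ ((h v - xs v + A : ℝ) : EReal) := fun v hv =>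
      iSup_le fun u => by
        have hu := hf u
        induction hfu : f u with
        | bot => exact absurd hfu hu
        | top => simp
        | coe r =>
          have := hh u r hfu.le v hv
          norm_cast
          linarith
    have hbot : fenchelConj f h ≠ ⊥ := by
      intro h0
      have h1 : ((h z₀ : ℝ) : EReal) - f z₀ ≤ fenchelConj f h :=
        le_iSup (fun x : E => ((h x : ℝ) : EReal) - f x) z₀
      rw [h0] at h1
      lift f z₀ to ℝ using ⟨hfz₀, hf z₀⟩ with r
      norm_cast at h1
    have htop : fenchelConj f h ≠ ⊤ :=
      ((hle z₀ hz₀).trans_lt (EReal.coe_lt_top _)).ne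
    -- The infimum is attained at `h`: the bounds in `hle`, read with `v` varying, bound the support
    -- function by `A - c`.
    refine (iInf_le _ h).trans ?_
    lift fenchelConj f h to ℝ using ⟨htop, hbot⟩ with c
    have hs : supportFun Ω (xs - h) ≤ ((A - c : ℝ) : EReal) := iSup₂_le fun v hv => by
      have := hle v hv
      norm_cast at this ⊢
      simp only [sub_apply]
      linarith
    refine (add_le_add le_rfl hs).trans (le_of_eq ?_)
    norm_cast
    ring

/-- A convex set in `E × ℝ` that lies above `0` on the fibre over `0` and is a neighbourhood of
some point of that fibre lies above a continuous linear functional. -/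
lemma Convex.exists_strongDual_le [IsTopologicalAddGroup E] [ContinuousSMul ℝ E]
    {C : Set (E × ℝ)} (hC : Convex ℝ C) (hC0 : ∀ r, (0, r) ∈ C → 0 ≤ r) {M : ℝ}
    (hM : C ∈ nhds ((0 : E), M)) :
    ∃ h : StrongDual ℝ E, ∀ p ∈ C, h p.1 ≤ p.2 := by
  have hint : ((0 : E), M) ∈ interior C := mem_interior_iff_mem_nhds.2 hM
  have h0 : ((0 : E), (0 : ℝ)) ∉ interior C := by
    intro h
    have hc : Filter.Tendsto (fun r : ℝ => ((0 : E), r)) (nhds 0) (nhds (0, 0)) :=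
      (Continuous.prodMk continuous_const continuous_id).tendsto 0
    have hev := hc.eventually (mem_interior_iff_mem_nhds.1 h)
    obtain ⟨ε, hε, hb⟩ := Metric.eventually_nhds_iff.1 hev
    have := hC0 _ (hb (y := -(ε / 2)) (by simp [abs_of_pos hε]; linarith))
    linarith
  obtain ⟨f, hf⟩ := geometric_hahn_banach_open_point hC.interior isOpen_interior h0
  -- Separation only controls the interior, but a convex set with nonempty interior lies in the
  -- closure of that interior.
  have hfC : ∀ p ∈ C, f p ≤ 0 := by
    intro p hp
    have hcl : p ∈ closure (interior C) := by
      rw [hC.closure_interior_eq_closure_of_nonempty_interior ⟨_, hint⟩]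
      exact subset_closure hp
    have hsub : closure (interior C) ⊆ {p | f p ≤ 0} :=
      closure_minimal (fun q hq => ((hf q hq).trans_eq (map_zero f)).le)
        (isClosed_le f.continuous continuous_const)
    exact hsub hcl
  have hdec : ∀ p : E × ℝ, f p = f (p.1, 0) + p.2 * f (0, 1) := fun p => by
    conv_lhs => rw [show p = (p.1, 0) + p.2 • ((0 : E), (1 : ℝ)) by ext <;> simp]
    rw [map_add, map_smul, smul_eq_mul]
  -- The hyperplane is not vertical: `f (0, M) = M * f (0, 1)` is negative while `M ≥ 0`.
  have hβ : f (0, 1) < 0 := by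
    have h1 := hf _ hint
    have h2 := hC0 M (interior_subset hint)
    have h3 := hdec ((0 : E), M)
    have h4 : f ((0 : E), (0 : ℝ)) = 0 := map_zero f
    simp only [h4, zero_add] at h1 h3
    by_contra! h5
    nlinarith [mul_nonneg h2 h5]
  refine ⟨(-f (0, 1))⁻¹ • f.comp (ContinuousLinearMap.inl ℝ E ℝ), fun p hp => ?_⟩
  have h1 := hfC p hp
  rw [hdec] at h1
  simp only [smul_apply, ContinuousLinearMap.comp_apply,
    ContinuousLinearMap.inl_apply, smul_eq_mul]
  rw [inv_mul_le_iff₀ (by linarith)]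
  linarith

/-- The condition is jointly convex in `(p, r, v)`, and projecting out `v` preserves convexity. The
map `ι` is the identity under continuity and the inclusion of the closed subspace in the Banach
case. -/
lemma Convex.setOf_sublevel_perturbation {E L : Type*} [AddCommGroup E] [Module ℝ E]
    [AddCommGroup L] [Module ℝ L]
    {f : E → EReal} (hf : IsConvexFun f) {Ω : Set E} (hΩ : Convex ℝ Ω) (ι : L →ₗ[ℝ] E)
    (w : E →ₗ[ℝ] ℝ) (A : ℝ) :
    Convex ℝ {p : L × ℝ | ∃ v ∈ Ω, f (ι p.1 + v) ≤ ((p.2 + w v - A : ℝ) : EReal)} := by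
  rintro ⟨p, r⟩ ⟨v, hv, h1⟩ ⟨q, s⟩ ⟨y, hy, h2⟩ a b ha hb hab
  refine ⟨a • v + b • y, hΩ hv hy ha hb hab, ?_⟩
  have h3 := hf.convex_epi (x := (ι p + v, r + w v - A)) h1 (y := (ι q + y, s + w y - A)) h2
    ha hb hab
  simp only [epigraphE, Set.mem_ofPred_eq, Prod.smul_mk, Prod.mk_add_mk, smul_eq_mul] at h3
  convert h3 using 2
  · simp only [Prod.smul_mk, Prod.mk_add_mk, map_add, map_smul, smul_add]
    abel
  · simp only [Prod.smul_mk, Prod.mk_add_mk, map_add, map_smul, smul_eq_mul]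
    linear_combination A * hab

/-- Fenchel duality under the continuity qualification. -/
lemma fenchelConj_add_indicatorE_eq_infConv_of_continuousAt [IsTopologicalAddGroup E]
    [ContinuousSMul ℝ E] {f : E → EReal} (hf : IsConvexFun f) {Ω : Set E} (hΩ : Convex ℝ Ω)
    {z₀ : E} (hz₀ : z₀ ∈ Ω) (hfz₀ : f z₀ ≠ ⊤) (hcont : ContinuousAt f z₀)
    (xs : StrongDual ℝ E) :
    fenchelConj (fun z => f z + indicatorE Ω z) xs =
      infConv (fenchelConj f) (supportFun Ω) xs := by
  refine fenchelConj_add_indicatorE_eq_infConv hf.ne_bot hz₀ hfz₀ xs fun A hA => ?_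
  have hconv := Convex.setOf_sublevel_perturbation hf hΩ LinearMap.id (xs : E →ₗ[ℝ] ℝ) A
  obtain ⟨m, hm, -⟩ := EReal.lt_iff_exists_real_btwn.1 (lt_top_iff_ne_top.2 hfz₀)
  obtain ⟨h, hh⟩ := hconv.exists_strongDual_le
    (fun r ⟨v, hv, h1⟩ => by
      have := hA v hv (r + xs v - A) (by simpa using h1)
      linarith)
    -- The single choice `v = z₀` serves all small perturbations, since `f < m` near `z₀`; the `1`
    -- leaves room in the vertical direction.
    (M := m + 1 - xs z₀ + A) (by
      have h1 : ∀ᶠ p : E × ℝ in nhds ((0 : E), m + 1 - xs z₀ + A), f (p.1 + z₀) < m := by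
        have hc : Filter.Tendsto (fun p : E × ℝ => p.1 + z₀)
            (nhds ((0 : E), m + 1 - xs z₀ + A)) (nhds z₀) := by
          have : Continuous fun p : E × ℝ => p.1 + z₀ := by fun_prop
          simpa using this.tendsto ((0 : E), m + 1 - xs z₀ + A)
        exact (hcont.tendsto.comp hc).eventually (gt_mem_nhds hm)
      have h2 : ∀ᶠ p : E × ℝ in nhds ((0 : E), m + 1 - xs z₀ + A), m - xs z₀ + A < p.2 :=
        continuous_snd.continuousAt.eventually (lt_mem_nhds (by simp))
      filter_upwards [h1, h2] with p hp1 hp2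
      refine ⟨z₀, hz₀, hp1.le.trans ?_⟩
      refine EReal.coe_le_coe_iff.2 ?_
      simp only [ContinuousLinearMap.coe_coe]
      linarith)
  refine ⟨h, fun u r hu v hv => ?_⟩
  have := hh (u - v, r - xs v + A) ⟨v, hv, by
    convert hu using 2
    · simp
    · simp only [ContinuousLinearMap.coe_coe]; ring⟩
  simpa using this

end Duality

/-! ### Baire category and the closed subspace condition -/

section Banach

/-- If a closed bounded convex set has a dense image in a ball of a subspace, then its image
contains the ball of half the radius. -/
lemma Convex.image_of_closure_image {E F : Type*} [NormedAddCommGroup E] [NormedSpace ℝ E]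
    [CompleteSpace E] [NormedAddCommGroup F] [NormedSpace ℝ F] (T : E →L[ℝ] F) {K : Set E}
    (hK : Convex ℝ K) (hKc : IsClosed K) (hKb : Bornology.IsBounded K) (L : Submodule ℝ F)
    (hTL : ∀ k ∈ K, T k ∈ L) {δ : ℝ} (hδ : 0 < δ)
    (hcl : ∀ y ∈ L, ‖y‖ < δ → y ∈ closure (T '' K)) :
    ∀ y ∈ L, ‖y‖ < δ / 2 → y ∈ T '' K := by
  intro y hyL hy
  have hstep : ∀ z : {z : F // z ∈ L ∧ ‖z‖ < δ}, ∃ k ∈ K, ‖(z : F) - T k‖ < δ / 2 := by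
    rintro ⟨z, hzL, hz⟩
    obtain ⟨_, ⟨k, hk, rfl⟩, hd⟩ := Metric.mem_closure_iff.1 (hcl z hzL hz) (δ / 2) (by linarith)
    exact ⟨k, hk, by rwa [← dist_eq_norm]⟩
  choose k hkK hk using hstep
  -- Successive approximation: the residual is less than `δ / 2`, so doubling it returns to the ball
  -- of radius `δ`.
  let next : {z : F // z ∈ L ∧ ‖z‖ < δ} → {z : F // z ∈ L ∧ ‖z‖ < δ} := fun z =>
    ⟨(2 : ℝ) • ((z : F) - T (k z)), L.smul_mem _ (L.sub_mem z.2.1 (hTL _ (hkK z))), by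
      rw [norm_smul]; have := hk z; norm_num; linarith⟩
  let z₀ : {z : F // z ∈ L ∧ ‖z‖ < δ} :=
    ⟨(2 : ℝ) • y, L.smul_mem _ hyL, by rw [norm_smul]; norm_num; linarith⟩
  let z : ℕ → {z : F // z ∈ L ∧ ‖z‖ < δ} := fun n => next^[n] z₀
  have hz : ∀ n, (z (n + 1) : F) = (2 : ℝ) • ((z n : F) - T (k (z n))) := fun n => by
    simp only [z, Function.iterate_succ_apply']; rfl
  let a : ℕ → E := fun n => ((1 / 2 : ℝ) ^ (n + 1)) • k (z n)
  have hpart : ∀ n, y = T (∑ i ∈ Finset.range n, a i) + ((1 / 2 : ℝ) ^ (n + 1)) • (z n : F) := by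
    intro n
    induction n with
    | zero => simp [z, z₀, smul_smul]
    | succ n ih =>
      rw [Finset.sum_range_succ, map_add, hz, smul_smul, smul_sub]
      nth_rewrite 1 [ih]
      simp only [a, map_smul]
      rw [show (1 / 2 : ℝ) ^ (n + 1 + 1) * 2 = (1 / 2 : ℝ) ^ (n + 1) by ring]
      abel
  obtain ⟨R, hR⟩ := hKb.exists_norm_le
  have hgeo : Summable fun n : ℕ => (1 / 2 : ℝ) ^ (n + 1) * R := by
    have := (summable_geometric_two.mul_left (1 / 2 : ℝ)).mul_right R
    simpa only [pow_succ'] using this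
  have hsum : Summable a := Summable.of_norm_bounded hgeo fun n => by
    simp only [a, norm_smul, norm_pow]
    rw [Real.norm_of_nonneg (by norm_num)]
    exact mul_le_mul_of_nonneg_left (hR _ (hkK _)) (by positivity)
  have hpow : Filter.Tendsto (fun n : ℕ => (1 / 2 : ℝ) ^ n) Filter.atTop (nhds 0) :=
    tendsto_pow_atTop_nhds_zero_of_lt_one (by norm_num) (by norm_num)
  refine ⟨∑' n, a n, ?_, ?_⟩
  -- The weights `1/2, ..., 1/2^n` miss total mass one by `1/2^n`; putting this on any point of `K`
  -- gives a convex combination, and the correction vanishes in the limit.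
  · have hmem : ∀ n, ∑ i ∈ Finset.range n, a i + ((1 / 2 : ℝ) ^ n) • k (z 0) ∈ K := by
      have haux : ∀ n, ∀ x ∈ K, ∑ i ∈ Finset.range n, a i + ((1 / 2 : ℝ) ^ n) • x ∈ K := by
        intro n
        induction n with
        | zero => intro x hx; simpa using hx
        | succ n ih =>
          intro x hx
          have h1 := ih _ (hK (hkK (z n)) hx (a := 1 / 2) (b := 1 / 2) (by norm_num) (by norm_num)
            (by norm_num))
          rw [Finset.sum_range_succ]
          convert h1 using 1
          simp only [a, smul_add, smul_smul, pow_succ]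
          abel
      exact fun n => haux n _ (hkK _)
    have hlim : Filter.Tendsto
        (fun n => ∑ i ∈ Finset.range n, a i + ((1 / 2 : ℝ) ^ n) • k (z 0)) Filter.atTop
        (nhds (∑' n, a n)) := by
      simpa using hsum.hasSum.tendsto_sum_nat.add (hpow.smul_const (k (z 0)))
    exact hKc.mem_of_tendsto hlim (Filter.Eventually.of_forall hmem)
  · have h1 : Filter.Tendsto (fun n => T (∑ i ∈ Finset.range n, a i)) Filter.atTop
        (nhds (T (∑' n, a n))) := (T.continuous.tendsto _).comp hsum.hasSum.tendsto_sum_nat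
    have h2 : Filter.Tendsto (fun n => T (∑ i ∈ Finset.range n, a i)) Filter.atTop (nhds y) := by
      rw [tendsto_iff_norm_sub_tendsto_zero]
      refine squeeze_zero (fun _ => norm_nonneg _) (g := fun n => (1 / 2 : ℝ) ^ n * δ) (fun n => ?_)
        (by simpa only [zero_mul] using hpow.mul_const δ)
      nth_rewrite 1 [hpart n]
      rw [sub_add_cancel_left, norm_neg, norm_smul, norm_pow, Real.norm_of_nonneg (by norm_num)]
      refine mul_le_mul ?_ (z n).2.2.le (norm_nonneg _) (by positivity)
      exact pow_le_pow_of_le_one (by norm_num) (by norm_num) (Nat.le_succ n)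
    exact tendsto_nhds_unique h1 h2

/-- An increasing sequence of closed bounded convex sets whose images absorb a closed subspace has
a member whose image contains a ball of that subspace. -/
lemma exists_ball_subset_image_of_absorbing {E F : Type*} [NormedAddCommGroup E]
    [NormedSpace ℝ E] [CompleteSpace E] [NormedAddCommGroup F] [NormedSpace ℝ F] [CompleteSpace F]
    (T : E →L[ℝ] F) {K : ℕ → Set E} (hmono : Monotone K) (hK : ∀ n, Convex ℝ (K n))
    (hKc : ∀ n, IsClosed (K n)) (hKb : ∀ n, Bornology.IsBounded (K n)) (L : Submodule ℝ F)
    (hL : IsClosed (L : Set F)) (hTL : ∀ n, ∀ k ∈ K n, T k ∈ L) {k₀ : E} (hk₀ : ∀ n, k₀ ∈ K n)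
    (hTk₀ : T k₀ = 0) (habs : ∀ p ∈ L, ∃ n, ∃ t : ℝ, 0 < t ∧ ∃ k ∈ K n, p = t • T k) :
    ∃ n, ∃ δ > 0, ∀ y ∈ L, ‖y‖ < δ → y ∈ T '' K n := by
  have hTK : ∀ n, Convex ℝ (T '' K n) := fun n => (hK n).linear_image (T : E →ₗ[ℝ] F)
  have hTmono : Monotone fun n => T '' K n := fun m n h => Set.image_mono (hmono h)
  have hstar : ∀ n, ∀ x ∈ T '' K n, ∀ s : ℝ, 0 ≤ s → s ≤ 1 → s • x ∈ T '' K n :=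
    fun n x hx s hs hs1 => (hTK n).smul_mem_of_zero_mem ⟨k₀, hk₀ n, hTk₀⟩ hx ⟨hs, hs1⟩
  have habs' : ∀ p ∈ L, ∃ n : ℕ, ∀ m ≥ n, ((m : ℝ) + 1)⁻¹ • p ∈ T '' K m := by
    intro p hp
    obtain ⟨n, t, ht, k, hk, rfl⟩ := habs p hp
    refine ⟨max n ⌈t⌉₊, fun m hm => ?_⟩
    rw [smul_smul]
    have htm : t ≤ m := (Nat.le_ceil t).trans (by exact_mod_cast (le_max_right _ _).trans hm)
    have hm0 : (0 : ℝ) < (m : ℝ) + 1 := by positivity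
    refine hstar m _ ⟨k, hmono ((le_max_left _ _).trans hm) hk, rfl⟩ _ (by positivity) ?_
    rw [inv_mul_le_iff₀ hm0]
    linarith
  have : CompleteSpace L := hL.completeSpace_coe
  -- Baire's theorem is applied in `L`, complete because closed.
  let C : ℕ → Set L := fun n => {p | ((n : ℝ) + 1)⁻¹ • (p : F) ∈ closure (T '' K n)}
  have hCc : ∀ n, IsClosed (C n) := fun n =>
    isClosed_closure.preimage (by fun_prop : Continuous fun p : L => ((n : ℝ) + 1)⁻¹ • (p : F))
  have hCU : ⋃ n, C n = Set.univ := Set.eq_univ_of_forall fun p => by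
    obtain ⟨n, hn⟩ := habs' p p.2
    exact Set.mem_iUnion.2 ⟨n, subset_closure (hn n le_rfl)⟩
  obtain ⟨n, q, hq⟩ := nonempty_interior_of_iUnion_of_closed hCc hCU
  obtain ⟨ε, hε, hball⟩ := Metric.mem_nhds_iff.1 (mem_interior_iff_mem_nhds.1 hq)
  -- The ball found is centred at `q`; a convex combination with a multiple of `-q` recentres it at
  -- `0`. The weights `d / (c + d)` and `c / (c + d)` cancel `q` and leave the scale factor `e`.
  obtain ⟨n', hn'⟩ := habs' (-q) (L.neg_mem q.2)
  set m := max n n' with hm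
  set c : ℝ := ((n : ℝ) + 1)⁻¹ with hc
  set d : ℝ := ((m : ℝ) + 1)⁻¹ with hd
  have hc0 : 0 < c := by positivity
  have hd0 : 0 < d := by positivity
  have hneg : d • (-(q : F)) ∈ T '' K m := hn' m (le_max_right _ _)
  refine ⟨m, (c * d / (c + d) * ε) / 2, by positivity, ?_⟩
  refine (hK m).image_of_closure_image T (hKc m) (hKb m) L (hTL m) (by positivity) ?_
  intro y hyL hy
  set e : ℝ := c * d / (c + d) with he
  have he0 : 0 < e := by positivity
  have hmem : q + e⁻¹ • (⟨y, hyL⟩ : L) ∈ C n := by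
    apply hball
    rw [Metric.mem_ball, dist_eq_norm, add_sub_cancel_left, norm_smul, norm_inv,
      Real.norm_of_nonneg he0.le, inv_mul_lt_iff₀ he0]
    simpa using hy
  have hmem' : c • ((q : F) + e⁻¹ • y) ∈ closure (T '' K m) :=
    closure_mono (hTmono (le_max_left n n')) hmem
  have := (hTK m).closure hmem' (subset_closure hneg) (a := d / (c + d)) (b := c / (c + d))
    (by positivity) (by positivity) (by field_simp; ring)
  convert this using 1
  rw [smul_smul, smul_smul, smul_add, smul_smul, smul_neg,
    show d / (c + d) * c * e⁻¹ = 1 by rw [he]; field_simp,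
    show d / (c + d) * c = c / (c + d) * d by ring, one_smul]
  abel

/-- Fenchel duality under the closed subspace qualification. -/
lemma fenchelConj_add_indicatorE_eq_infConv_of_isClosedSubspace {E : Type*}
    [NormedAddCommGroup E] [NormedSpace ℝ E] [CompleteSpace E] {f : E → EReal}
    (hf : IsConvexFun f) {Ω : Set E} (hΩ : Convex ℝ Ω) (hlsc : LowerSemicontinuous f)
    (hΩc : IsClosed Ω) (hsub : IsClosedSubspace (posMultiples (effDom f - Ω)))
    (xs : StrongDual ℝ E) :
    fenchelConj (fun z => f z + indicatorE Ω z) xs =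
      infConv (fenchelConj f) (supportFun Ω) xs := by
  obtain ⟨hLc, L, hL⟩ := hsub
  rw [← hL] at hLc
  have hmemL : ∀ p, p ∈ L ↔ p ∈ posMultiples (effDom f - Ω) := fun p => by
    rw [← hL, SetLike.mem_coe]
  have hsubL : ∀ u v, f u < ⊤ → v ∈ Ω → u - v ∈ L := fun u v hu hv =>
    (hmemL _).2 ⟨1, one_pos, _, Set.sub_mem_sub hu hv, (one_smul ℝ _).symm⟩
  obtain ⟨z₀, hz₀, hfz₀⟩ : ∃ z ∈ Ω, f z < ⊤ := by
    obtain ⟨t, ht, _, ⟨u, hu, v, hv, rfl⟩, h0⟩ := (hmemL 0).1 L.zero_mem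
    have huv : u - v = 0 := (smul_eq_zero.1 h0.symm).resolve_left ht.ne'
    rw [sub_eq_zero] at huv
    exact ⟨u, huv ▸ hv, hu⟩
  refine fenchelConj_add_indicatorE_eq_infConv hf.ne_bot hz₀ hfz₀.ne xs fun A hA => ?_
  have hreal : ∀ u, f u < ⊤ → ∃ m : ℕ, f u ≤ (m : ℝ) := fun u hu => by
    obtain ⟨r, hr, -⟩ := EReal.lt_iff_exists_real_btwn.1 hu
    exact ⟨⌈r⌉₊, hr.le.trans (by exact_mod_cast Nat.le_ceil r)⟩
  obtain ⟨m₀, hm₀⟩ := hreal z₀ hfz₀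
  -- The shift by `N` puts `(z₀, z₀)`, which the difference map sends to `0`, into every `K n`.
  set N : ℕ := m₀ + ⌈‖z₀‖⌉₊ with hN
  let K : ℕ → Set (E × E) := fun n =>
    {u | f u ≤ ((n + N : ℕ) : ℝ)} ×ˢ Ω ∩ Metric.closedBall 0 ((n + N : ℕ) : ℝ)
  have hsubl : ∀ r : ℝ, Convex ℝ {u | f u ≤ r} := fun r u hu v hv a b ha hb hab => by
    have h := hf.convex_epi (x := (u, r)) hu (y := (v, r)) hv ha hb hab
    simpa [epigraphE, ← add_mul, hab] using h
  have hKmono : Monotone K := fun m n hmn => by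
    have hr : ((m + N : ℕ) : ℝ) ≤ ((n + N : ℕ) : ℝ) := by exact_mod_cast Nat.add_le_add_right hmn N
    refine Set.inter_subset_inter (Set.prod_mono (fun u hu => ?_) subset_rfl)
      (Metric.closedBall_subset_closedBall hr)
    exact le_trans hu (EReal.coe_le_coe_iff.2 hr)
  let T : E × E →L[ℝ] E := ContinuousLinearMap.fst ℝ E E - ContinuousLinearMap.snd ℝ E E
  obtain ⟨n, δ, hδ, hball⟩ := exists_ball_subset_image_of_absorbing T hKmono
    (fun n => ((hsubl _).prod hΩ).inter (convex_closedBall _ _))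
    (fun n => ((hlsc.isClosed_preimage _).prod hΩc).inter Metric.isClosed_closedBall)
    (fun n => Metric.isBounded_closedBall.subset Set.inter_subset_right) L hLc
    (fun n k hk => hsubL _ _ (lt_of_le_of_lt hk.1.1 (EReal.coe_lt_top _)) hk.1.2)
    (k₀ := (z₀, z₀)) (fun n => by
      refine ⟨⟨hm₀.trans ?_, hz₀⟩, ?_⟩
      · exact EReal.coe_le_coe_iff.2 (by exact_mod_cast (by omega : m₀ ≤ n + N))
      · rw [mem_closedBall_zero_iff, Prod.norm_def, max_self]
        exact (Nat.le_ceil _).trans (by exact_mod_cast (by omega : ⌈‖z₀‖⌉₊ ≤ n + N)))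
    (by simp [T])
    (fun p hp => by
      obtain ⟨t, ht, _, ⟨u, hu, v, hv, rfl⟩, h0⟩ := (hmemL p).1 hp
      obtain ⟨m, hm⟩ := hreal u hu
      refine ⟨m + ⌈‖(u, v)‖⌉₊, t, ht, (u, v), ⟨⟨hm.trans ?_, hv⟩, ?_⟩, h0⟩
      · exact EReal.coe_le_coe_iff.2
          (by exact_mod_cast (by omega : m ≤ m + ⌈‖(u, v)‖⌉₊ + N))
      · rw [mem_closedBall_zero_iff]
        exact (Nat.le_ceil _).trans
          (by exact_mod_cast (by omega : ⌈‖(u, v)‖⌉₊ ≤ m + ⌈‖(u, v)‖⌉₊ + N)))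
  have hconv := Convex.setOf_sublevel_perturbation hf hΩ L.subtype (xs : E →ₗ[ℝ] ℝ) A
  set R : ℝ := ((n + N : ℕ) : ℝ) with hR
  obtain ⟨h, hh⟩ := hconv.exists_strongDual_le
    (fun r ⟨v, hv, h1⟩ => by
      have := hA v hv (r + xs v - A) (by simpa using h1)
      linarith)
    -- On `K n` both `f u ≤ R` and `-xs v ≤ ‖xs‖ * R`, so `f u - xs v + A` stays at least `1` below
    -- this height.
    (M := R + ‖xs‖ * R + A + 1) (by
      have h1 : ∀ᶠ p : L × ℝ in nhds ((0 : L), R + ‖xs‖ * R + A + 1), ‖p.1‖ < δ :=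
        (continuous_fst.norm).continuousAt.eventually (gt_mem_nhds (by simpa using hδ))
      have h2 : ∀ᶠ p : L × ℝ in nhds ((0 : L), R + ‖xs‖ * R + A + 1),
          R + ‖xs‖ * R + A < p.2 :=
        continuous_snd.continuousAt.eventually (lt_mem_nhds (by simp))
      filter_upwards [h1, h2] with p hp1 hp2
      obtain ⟨⟨u, v⟩, ⟨⟨hu, hv⟩, hb⟩, huv⟩ := hball p.1 p.1.2 hp1
      have hvR : ‖v‖ ≤ R := (norm_snd_le (u, v)).trans (mem_closedBall_zero_iff.1 hb)
      have hxv : |xs v| ≤ ‖xs‖ * R :=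
        (xs.le_opNorm v).trans (mul_le_mul_of_nonneg_left hvR (norm_nonneg _))
      have huv' : (p.1 : E) + v = u := by
        rw [← huv]; simp [T]
      refine ⟨v, hv, ?_⟩
      rw [Submodule.subtype_apply, huv']
      refine le_trans hu (EReal.coe_le_coe_iff.2 ?_)
      have := (abs_le.1 hxv).1
      simp only [ContinuousLinearMap.coe_coe]
      linarith)
  obtain ⟨g, hg, -⟩ := exists_extension_norm_eq L h
  refine ⟨g, fun u r hu v hv => ?_⟩
  have huv := hsubL u v (hu.trans_lt (EReal.coe_lt_top r)) hv
  have h1 := hh (⟨u - v, huv⟩, r - xs v + A) ⟨v, hv, by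
    convert hu using 2
    · simp
    · simp only [ContinuousLinearMap.coe_coe]; ring⟩
  rw [← map_sub]
  exact (hg ⟨u - v, huv⟩).le.trans h1

end Banach

/-- The first conjunct covers arbitrary Hausdorff locally convex spaces; the second one covers
Banach spaces. The functional `(x*, 0)` on `X × Y` is `xs.coprod 0`, that is
`(x, y) ↦ ⟨x*, x⟩ + 0`. -/
theorem theorem5p1 :
    (∀ (X Y : Type*)
        [AddCommGroup X] [Module ℝ X] [TopologicalSpace X] [IsTopologicalAddGroup X]
        [ContinuousSMul ℝ X] [LocallyConvexSpace ℝ X] [T2Space X]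
        [AddCommGroup Y] [Module ℝ Y] [TopologicalSpace Y] [IsTopologicalAddGroup Y]
        [ContinuousSMul ℝ Y] [LocallyConvexSpace ℝ Y] [T2Space Y]
        (φ : X × Y → EReal) (F : X → Set Y),
        IsConvexFun φ → Convex ℝ (gphOf F) →
        (∀ xs : StrongDual ℝ X,
          fenchelConj (marginalFun φ F) xs =
            fenchelConj (fun z => φ z + indicatorE (gphOf F) z) (xs.coprod (0 : StrongDual ℝ Y))) ∧
        ((∃ z ∈ gphOf F, φ z ≠ ⊤ ∧ ContinuousAt φ z) →
          ∀ xs : StrongDual ℝ X,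
            fenchelConj (marginalFun φ F) xs =
              infConv (fenchelConj φ) (supportFun (gphOf F)) (xs.coprod (0 : StrongDual ℝ Y)))) ∧
    (∀ (X Y : Type*)
        [NormedAddCommGroup X] [NormedSpace ℝ X] [CompleteSpace X]
        [NormedAddCommGroup Y] [NormedSpace ℝ Y] [CompleteSpace Y]
        (φ : X × Y → EReal) (F : X → Set Y),
        IsConvexFun φ → Convex ℝ (gphOf F) →
        LowerSemicontinuous φ → IsClosed (gphOf F) →
        IsClosedSubspace (posMultiples (effDom φ - gphOf F)) →
        ∀ xs : StrongDual ℝ X,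
          fenchelConj (marginalFun φ F) xs =
            infConv (fenchelConj φ) (supportFun (gphOf F)) (xs.coprod (0 : StrongDual ℝ Y))) := by
  refine ⟨?_, ?_⟩
  · intro X Y _ _ _ _ _ _ _ _ _ _ _ _ _ _ φ F hφ hF
    refine ⟨fun xs => fenchelConj_marginalFun hφ.ne_bot F xs, ?_⟩
    rintro ⟨z, hz, hφz, hc⟩ xs
    rw [fenchelConj_marginalFun hφ.ne_bot]
    exact fenchelConj_add_indicatorE_eq_infConv_of_continuousAt hφ hF hz hφz hc _
  · intro X Y _ _ _ _ _ _ φ F hφ hF hlsc hFc hsub xs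
    rw [fenchelConj_marginalFun hφ.ne_bot]
    exact fenchelConj_add_indicatorE_eq_infConv_of_isClosedSubspace hφ hF hlsc hFc hsub _
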